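/- Let $\mathbb{F}$ be a field and, for $n\ge 1$, let $U_n=U_n(\mathbb{F})$ be the group of $n\times n$ upper-triangular matrices over $\mathbb{F}$ with $1$'s on the main diagonal. For $N\ge 1$ let $\pi(N)$ be the proportion of the integers $n$ with $1\le n\le N$ for which $U_n$ has a subgroup that is generated by two (not necessarily distinct) elements and has the same derived length as $U_n$ itself (the maximal possible derived length of a subgroup of $U_n$). Then $$\frac{11}{21}<\pi(N)\le 1\quad\text{for all } N\ge 1,\qquad \liminf_{N\to\infty}\pi(N)=\frac{11}{21},\qquad \limsup_{N\to\infty}\pi(N)=\frac{11}{16}.$$ -/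

import Mathlib

/-- The group `U_n(F)` of all upper-triangular `n × n` matrices over `F` with `1`s on the main
diagonal, as a subgroup of `GL_n(F)`. -/
def unitriangular (n : ℕ) (F : Type*) [Field F] : Subgroup (Matrix.GeneralLinearGroup (Fin n) F) where
  carrier := {g | (∀ i, g.1 i i = 1) ∧ ∀ i j, j < i → g.1 i j = 0}
  one_mem' := by
    refine ⟨fun i => ?_, fun i j h => ?_⟩
    · simp
    · simp [h.ne']
  mul_mem' := by
    rintro a b ⟨ha, ha'⟩ ⟨hb, hb'⟩
    refine ⟨fun i => ?_, fun i j h => ?_⟩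
    · rw [Units.val_mul, Matrix.mul_apply, Finset.sum_eq_single i]
      · rw [ha, hb, one_mul]
      · intro k _ hk
        rcases lt_or_gt_of_ne hk with h | h
        · rw [ha' _ _ h, zero_mul]
        · rw [hb' _ _ h, mul_zero]
      · simp
    · rw [Units.val_mul, Matrix.mul_apply]
      refine Finset.sum_eq_zero fun k _ => ?_
      rcases lt_or_ge k i with hk | hk
      · rw [ha' _ _ hk, zero_mul]
      · rw [hb' _ _ (h.trans_le hk), mul_zero]
  inv_mem' := by
    rintro a ⟨ha, ha'⟩
    have key : ∀ i j, j < i → (a⁻¹).1 i j = 0 := by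
      have hT : a.1.BlockTriangular id := fun i j h => ha' i j h
      haveI : Invertible a.1 := a.invertible
      have := Matrix.blockTriangular_inv_of_blockTriangular hT
      intro i j h
      rw [Matrix.coe_units_inv]
      exact this h
    refine ⟨fun i => ?_, key⟩
    have h1 : (a.1 * (a⁻¹).1) i i = 1 := by
      rw [← Units.val_mul, mul_inv_cancel]; simp
    rw [Matrix.mul_apply, Finset.sum_eq_single i] at h1
    · rwa [ha, one_mul] at h1
    · intro k _ hk
      rcases lt_or_gt_of_ne hk with h | h
      · rw [ha' _ _ h, zero_mul]
      · rw [key _ _ h, mul_zero]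
    · simp

/-- The group `G` is solvable of derived length exactly `d`. -/
def HasDerivedLength (G : Type*) [Group G] (d : ℕ) : Prop :=
  derivedSeries G d = ⊥ ∧ ∀ k < d, derivedSeries G k ≠ ⊥

/-- `G` has a subgroup generated by two elements whose derived length equals that of `G`
(the largest possible derived length of a subgroup of `G`). -/
def HasTwoGenSubgroupOfMaxDerivedLength (G : Type*) [Group G] : Prop :=
  ∃ d : ℕ, HasDerivedLength G d ∧
    ∃ a b : G, HasDerivedLength (Subgroup.closure {a, b} : Subgroup G) d

open Classical in
/-- The proportion of those `n` with `1 ≤ n ≤ N` for which `U_n(F)` has a subgroup generated by two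
elements and of maximal derived length. -/
noncomputable def twoGenProportion (F : Type*) [Field F] (N : ℕ) : ℝ :=
  (((Finset.Icc 1 N).filter fun n =>
    HasTwoGenSubgroupOfMaxDerivedLength (unitriangular n F)).card : ℝ) / (N : ℝ)

/-! The group `U_n` is filtered by depth, the index of the first superdiagonal on which `u - 1` may
be nonzero. Group commutators have the matrix commutator as leading term, so depth at least doubles
at each derived step. Elementary matrices show that this is sharp for `U_n`: for `2 ^ d < n ≤ 2 ^ (d
+ 1)` its derived length is `d + 1`. A two-generated subgroup attains it iff its `d`-th derived
subgroup can be nontrivial.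

Two generators give little room at low depth. Modulo deeper terms, the first derived subgroup is
spanned by one element of degree 2 and two of degree 3, so the second starts in degree 5 with at
most two dimensions, the third in degree 10 with at most one, and the fourth, since `[D, D] = 0`,
only in degree 21. Doubling then gives the bound `⌊21 * 2 ^ d / 16⌋` of
`derivedSeries_le_bandLevel_of_closure_pair_eq_top`.

The bound is sharp. Explicit Lie monomials attain the small degrees, and in degree 21 three
independent ones exist. The exterior square of a three-dimensional space is again three-dimensional,
so bracketing pairs keeps three independent elements at every doubling
(`IsTriangularTriple.exists_double`). Evaluating such a polynomial on two matrices read off from a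
word realises any chosen coefficient as a matrix entry.

Hence, for `2 ^ d < n ≤ 2 ^ (d + 1)`, the good `n` are exactly those above `⌊21 * 2 ^ d / 16⌋`. The
proportion tends to `11 / 16` along powers of two, where it peaks, and to `11 / 21` along `N = 21 *
2 ^ e`, just before good values resume. -/

/-- The matrices supported on the diagonals `j - i ≥ k`. -/
def band (n : ℕ) (F : Type*) [Field F] (k : ℕ) : Submodule F (Matrix (Fin n) (Fin n) F) where
  carrier := {M | ∀ i j : Fin n, (j : ℕ) < i + k → M i j = 0}
  zero_mem' := fun _ _ _ => rfl
  add_mem' := fun {a b} ha hb i j h => by rw [Matrix.add_apply, ha i j h, hb i j h, add_zero]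
  smul_mem' := fun c a ha i j h => by rw [Matrix.smul_apply, ha i j h, smul_zero]

/-! ### The depth filtration and leading terms of commutators. -/

section Band

open scoped commutatorElement

variable {n : ℕ} {F : Type*} [Field F]

lemma mem_band {k : ℕ} {M : Matrix (Fin n) (Fin n) F} :
    M ∈ band n F k ↔ ∀ i j : Fin n, (j : ℕ) < i + k → M i j = 0 := Iff.rfl

lemma band_anti {k l : ℕ} (h : k ≤ l) : band n F l ≤ band n F k :=
  fun _ hM i j hij => hM i j (by omega)

lemma band_mul_mem {k l : ℕ} {M N : Matrix (Fin n) (Fin n) F} (hM : M ∈ band n F k)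
    (hN : N ∈ band n F l) : M * N ∈ band n F (k + l) := by
  intro i j hij
  rw [Matrix.mul_apply]
  refine Finset.sum_eq_zero fun m _ => ?_
  rcases lt_or_ge (m : ℕ) (i + k) with h | h
  · rw [hM i m h, zero_mul]
  · rw [hN m j (by omega), mul_zero]

lemma band_mul_mem_of_le {k l m : ℕ} {M N : Matrix (Fin n) (Fin n) F} (hM : M ∈ band n F k)
    (hN : N ∈ band n F l) (h : m ≤ k + l) : M * N ∈ band n F m :=
  band_anti h (band_mul_mem hM hN)

lemma band_lie_mem_of_le {k l m : ℕ} {M N : Matrix (Fin n) (Fin n) F} (hM : M ∈ band n F k)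
    (hN : N ∈ band n F l) (h : m ≤ k + l) : M * N - N * M ∈ band n F m :=
  sub_mem (band_mul_mem_of_le hM hN h) (band_mul_mem_of_le hN hM (by omega))

lemma eq_zero_of_mem_band {k : ℕ} (hk : n ≤ k) {M : Matrix (Fin n) (Fin n) F}
    (hM : M ∈ band n F k) : M = 0 := by
  ext i j
  exact hM i j (by omega)

/-- The strictly upper-triangular part `u - 1` of a unitriangular matrix. -/
def nilPart (u : unitriangular n F) : Matrix (Fin n) (Fin n) F := u.1.1 - 1

lemma val_eq_one_add_nilPart (u : unitriangular n F) : u.1.1 = 1 + nilPart u := by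
  simp [nilPart]

lemma nilPart_mem_band_one (u : unitriangular n F) : nilPart u ∈ band n F 1 := by
  intro i j hij
  rcases eq_or_ne i j with rfl | h
  · simp [nilPart, u.2.1 i]
  · have : j < i := lt_of_le_of_ne (Fin.le_def.2 (by omega)) h.symm
    simp [nilPart, u.2.2 i j this, Matrix.one_apply_ne h]

lemma nilPart_one : nilPart (1 : unitriangular n F) = 0 := by simp [nilPart]

lemma nilPart_mul (u v : unitriangular n F) :
    nilPart (u * v) = nilPart u + nilPart v + nilPart u * nilPart v := by
  simp only [nilPart, Subgroup.coe_mul, Units.val_mul]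
  noncomm_ring

lemma nilPart_inv (u : unitriangular n F) :
    nilPart u⁻¹ = -nilPart u - nilPart u * nilPart u⁻¹ := by
  have h := nilPart_mul u u⁻¹
  rw [mul_inv_cancel, nilPart_one] at h
  rw [eq_comm, ← sub_eq_zero, ← neg_eq_zero, h]
  abel

lemma nilPart_eq_zero {u : unitriangular n F} (h : nilPart u = 0) : u = 1 := by
  apply Subtype.ext
  apply Units.ext
  rw [val_eq_one_add_nilPart, h]
  simp

lemma exists_nilPart_eq {N : Matrix (Fin n) (Fin n) F} (hN : N ∈ band n F 1) :
    ∃ u : unitriangular n F, nilPart u = N := by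
  have hT : (1 + N).BlockTriangular id := fun i j (h : j < i) => by
    have := Fin.lt_def.1 h
    rw [Matrix.add_apply, hN i j (by omega), Matrix.one_apply_ne h.ne', add_zero]
  have hd : ∀ i, (1 + N) i i = 1 := fun i => by
    rw [Matrix.add_apply, hN i i (by omega), Matrix.one_apply_eq, add_zero]
  have hdet : (1 + N).det ≠ 0 := by
    rw [Matrix.det_of_isUpperTriangular hT]
    simp [hd]
  refine ⟨⟨Matrix.GeneralLinearGroup.mkOfDetNeZero (1 + N) hdet, hd, fun i j h => hT h⟩, ?_⟩
  simp [nilPart]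

/-- Since `⁅g, h⁆ = (g * h) * (h * g)⁻¹`, one has `⁅g, h⁆ - 1 = (gh - hg)(hg)⁻¹`, and `gh - hg` is
the matrix commutator of the nilpotent parts. -/
lemma nilPart_commutator (g h : unitriangular n F) :
    nilPart ⁅g, h⁆ - (nilPart g * nilPart h - nilPart h * nilPart g) =
      (nilPart g * nilPart h - nilPart h * nilPart g) * nilPart (h * g)⁻¹ := by
  have h1 : ⁅g, h⁆ = (g * h) * (h * g)⁻¹ := by
    rw [commutatorElement_def, mul_inv_rev]
    group
  have h2 : ∀ p q : unitriangular n F,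
      nilPart (p * q⁻¹) = (nilPart p - nilPart q) * (1 + nilPart q⁻¹) := by
    intro p q
    have h3 := nilPart_mul q q⁻¹
    rw [mul_inv_cancel, nilPart_one] at h3
    rw [nilPart_mul, sub_mul, mul_add, mul_add, mul_one, mul_one, ← sub_eq_zero]
    rw [h3]
    abel
  rw [h1, h2, nilPart_mul g h, nilPart_mul h g]
  noncomm_ring

/-- A submodule of matrices lying between two bands gives a subgroup of the unitriangular
group. -/
def bandSubgroup (P : Submodule F (Matrix (Fin n) (Fin n) F)) (k : ℕ)
    (h1 : band n F (2 * k) ≤ P) (h2 : P ≤ band n F k) : Subgroup (unitriangular n F) where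
  carrier := {u | nilPart u ∈ P}
  one_mem' := by simp [nilPart_one]
  mul_mem' := fun {u v} hu hv => by
    change nilPart (u * v) ∈ P
    rw [nilPart_mul]
    exact add_mem (add_mem hu hv) (h1 (band_mul_mem_of_le (h2 hu) (h2 hv) (by omega)))
  inv_mem' := fun {u} hu => by
    change nilPart u⁻¹ ∈ P
    -- Bootstrap: depth `k` of the inverse puts the product in `nilPart_inv` at depth `2 * k`, where
    -- it lies in `P`.
    have h3 : nilPart u⁻¹ ∈ band n F k := by
      rw [nilPart_inv]
      exact sub_mem (neg_mem (h2 hu))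
        (band_mul_mem_of_le (h2 hu) (nilPart_mem_band_one u⁻¹) (by omega))
    rw [nilPart_inv]
    exact sub_mem (neg_mem hu) (h1 (band_mul_mem_of_le (h2 hu) h3 (by omega)))

lemma mem_bandSubgroup {P : Submodule F (Matrix (Fin n) (Fin n) F)} {k : ℕ}
    {h1 : band n F (2 * k) ≤ P} {h2 : P ≤ band n F k} {u : unitriangular n F} :
    u ∈ bandSubgroup P k h1 h2 ↔ nilPart u ∈ P := Iff.rfl

/-- The unitriangular matrices with vanishing entries on the diagonals `0 < j - i < k`. -/
def bandLevel (n : ℕ) (F : Type*) [Field F] (k : ℕ) : Subgroup (unitriangular n F) :=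
  bandSubgroup (band n F k) k (band_anti (by omega)) le_rfl

lemma mem_bandLevel {k : ℕ} {u : unitriangular n F} :
    u ∈ bandLevel n F k ↔ nilPart u ∈ band n F k := Iff.rfl

/-- The error is the bracket times a nilpotent part, so it gains the smaller of the two depths. The
`max 1` records that every nilpotent part has depth at least 1, even if `k` or `l` is 0. -/
lemma nilPart_commutator_sub_mem {k l : ℕ} {g h : unitriangular n F}
    (hg : nilPart g ∈ band n F k) (hh : nilPart h ∈ band n F l) {m : ℕ}
    (hm : m ≤ k + l + min (max 1 k) (max 1 l)) :
    nilPart ⁅g, h⁆ - (nilPart g * nilPart h - nilPart h * nilPart g) ∈ band n F m := by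
  rw [nilPart_commutator]
  have key : ∀ (r : ℕ) (u : unitriangular n F), nilPart u ∈ band n F r →
      nilPart u ∈ band n F (max 1 r) := fun r u hu => by
    rcases max_choice 1 r with h | h
    · rw [h]; exact nilPart_mem_band_one u
    · rwa [h]
  have h1 : (h * g)⁻¹ ∈ bandLevel n F (min (max 1 k) (max 1 l)) := by
    refine inv_mem (mul_mem ?_ ?_)
    · exact band_anti (min_le_right _ _) (key _ _ hh)
    · exact band_anti (min_le_left _ _) (key _ _ hg)
  exact band_mul_mem_of_le (band_lie_mem_of_le hg hh le_rfl) h1 hm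

lemma nilPart_commutator_mem {k l m : ℕ} {g h : unitriangular n F}
    (hg : nilPart g ∈ band n F k) (hh : nilPart h ∈ band n F l) (hm : m ≤ k + l) :
    nilPart ⁅g, h⁆ ∈ band n F m := by
  have h1 := nilPart_commutator_sub_mem hg hh (m := m) (by omega)
  simpa using add_mem h1 (band_lie_mem_of_le hg hh hm)

end Band

/-! ### Derived length of the full unitriangular group. -/

section DerivedSeries

open scoped commutatorElement

variable {n : ℕ} {F : Type*} [Field F] {Γ : Type*} [Group Γ]

lemma derivedSeries_succ_le_comap {G : Type*} [Group G] (φ : Γ →* G) {d : ℕ}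
    {K L : Subgroup G} (hK : derivedSeries Γ d ≤ K.comap φ)
    (h : ∀ x ∈ K, ∀ y ∈ K, ⁅x, y⁆ ∈ L) : derivedSeries Γ (d + 1) ≤ L.comap φ := by
  rw [derivedSeries_succ, Subgroup.commutator_le]
  intro x hx y hy
  rw [Subgroup.mem_comap, map_commutatorElement]
  exact h _ (hK hx) _ (hK hy)

lemma derivedSeries_le_bandLevel_two_pow_mul (φ : Γ →* unitriangular n F) {d k : ℕ}
    (h : derivedSeries Γ d ≤ (bandLevel n F k).comap φ) (e : ℕ) :
    derivedSeries Γ (d + e) ≤ (bandLevel n F (k * 2 ^ e)).comap φ := by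
  induction e with
  | zero => simpa using h
  | succ e ih =>
    refine derivedSeries_succ_le_comap φ ih fun x hx y hy => ?_
    exact nilPart_commutator_mem hx hy (by rw [pow_succ]; exact le_of_eq (by ring))

lemma derivedSeries_eq_bot_of_le_bandLevel {φ : Γ →* unitriangular n F}
    (hφ : Function.Injective φ) {d k : ℕ} (hk : n ≤ k)
    (h : derivedSeries Γ d ≤ (bandLevel n F k).comap φ) : derivedSeries Γ d = ⊥ := by
  rw [eq_bot_iff]
  intro g hg
  have h1 := nilPart_eq_zero (eq_zero_of_mem_band hk (h hg))
  exact hφ (h1.trans φ.map_one.symm)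

/-- The derived series of the unitriangular group vanishes from `⌈log₂ n⌉` on. -/
lemma derivedSeries_unitriangular_eq_bot {d : ℕ} (h : n ≤ 2 ^ d) :
    derivedSeries (unitriangular n F) d = ⊥ := by
  have h0 : derivedSeries (unitriangular n F) 0 ≤
      (bandLevel n F 1).comap (MonoidHom.id (unitriangular n F)) :=
    fun u _ => nilPart_mem_band_one u
  have h1 := derivedSeries_le_bandLevel_two_pow_mul _ h0 d
  rw [Nat.zero_add] at h1
  exact derivedSeries_eq_bot_of_le_bandLevel (fun _ _ h => h) (by omega) h1

lemma single_mem_band {i j : Fin n} {k : ℕ} (h : (i : ℕ) + k ≤ j) :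
    Matrix.single i j (1 : F) ∈ band n F k := by
  intro a b hab
  rw [Matrix.single_apply_of_ne]
  rintro ⟨rfl, rfl⟩
  omega

/-- Induction through the midpoint `l` of `i` and `j`: `E_ij = [E_il, E_lj]`, and the deeper errors
of both factors stay deeper after bracketing. -/
lemma exists_mem_derivedSeries_nilPart_sub_single_mem (d : ℕ) (i j : Fin n)
    (hij : (j : ℕ) = i + 2 ^ d) : ∃ g ∈ derivedSeries (unitriangular n F) d,
      nilPart g - Matrix.single i j 1 ∈ band n F (2 ^ d + 1) := by
  induction d generalizing i j with
  | zero =>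
    obtain ⟨u, hu⟩ := exists_nilPart_eq (single_mem_band (F := F) (i := i) (j := j) (k := 1)
      (by rw [hij]; omega))
    exact ⟨u, by simp, by simp [hu]⟩
  | succ d ih =>
    have hp : 2 ^ (d + 1) = 2 ^ d + 2 ^ d := by ring
    have hpos : 0 < 2 ^ d := by positivity
    have hl : (i : ℕ) + 2 ^ d < n := by omega
    obtain ⟨g, hg, hg'⟩ := ih i ⟨i + 2 ^ d, hl⟩ rfl
    obtain ⟨h, hh, hh'⟩ := ih ⟨i + 2 ^ d, hl⟩ j (by simp only; omega)
    set l : Fin n := ⟨i + 2 ^ d, hl⟩ with hl_def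
    refine ⟨⁅g, h⁆, Subgroup.commutator_mem_commutator hg hh, ?_⟩
    have hx : Matrix.single i l (1 : F) ∈ band n F (2 ^ d) := single_mem_band le_rfl
    have hy : Matrix.single l j (1 : F) ∈ band n F (2 ^ d) :=
      single_mem_band (by simp only [hl_def]; omega)
    have hij' : j ≠ i := by
      rintro rfl
      omega
    have gx : nilPart g ∈ band n F (2 ^ d) := by
      simpa using add_mem (band_anti (Nat.le_succ _) hg') hx
    have hyy : nilPart h ∈ band n F (2 ^ d) := by
      simpa using add_mem (band_anti (Nat.le_succ _) hh') hy
    have h1 := nilPart_commutator_sub_mem gx hyy (m := 2 ^ (d + 1) + 1) (by omega)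
    have h2 : Matrix.single i j (1 : F) =
        Matrix.single i l 1 * Matrix.single l j 1 - Matrix.single l j 1 * Matrix.single i l 1 := by
      rw [Matrix.single_mul_single_same, Matrix.single_mul_single_of_ne _ _ _ _ hij']
      simp
    have h3 : nilPart g * nilPart h - nilPart h * nilPart g - Matrix.single i j (1 : F) =
        ((nilPart g - Matrix.single i l 1) * nilPart h -
          nilPart h * (nilPart g - Matrix.single i l 1)) +
        (Matrix.single i l 1 * (nilPart h - Matrix.single l j 1) -
          (nilPart h - Matrix.single l j 1) * Matrix.single i l 1) := by
      rw [h2]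
      noncomm_ring
    have h4 : nilPart g * nilPart h - nilPart h * nilPart g - Matrix.single i j (1 : F) ∈
        band n F (2 ^ (d + 1) + 1) := by
      rw [h3]
      exact add_mem (band_lie_mem_of_le hg' hyy (by omega))
        (band_lie_mem_of_le hx hh' (by omega))
    simpa using add_mem h1 h4

lemma derivedSeries_unitriangular_ne_bot {d : ℕ} (h : 2 ^ d < n) :
    derivedSeries (unitriangular n F) d ≠ ⊥ := by
  intro hbot
  obtain ⟨g, hg, hg'⟩ := exists_mem_derivedSeries_nilPart_sub_single_mem (F := F) d
    ⟨0, (Nat.zero_le _).trans_lt h⟩ ⟨2 ^ d, h⟩ (by simp)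
  rw [hbot, Subgroup.mem_bot] at hg
  have := hg' ⟨0, (Nat.zero_le _).trans_lt h⟩ ⟨2 ^ d, h⟩ (by simp)
  simp [hg, nilPart_one] at this

lemma HasDerivedLength.unique {d e : ℕ} (hd : HasDerivedLength Γ d) (he : HasDerivedLength Γ e) :
    d = e :=
  le_antisymm (not_lt.1 fun h => hd.2 _ h he.1) (not_lt.1 fun h => he.2 _ h hd.1)

end DerivedSeries

/-! ### Upper bound: two-generated groups lose depth in the first four derived steps. -/

section TwoGenerated

open scoped commutatorElement

/-- The commutator subgroup of a two-generated group is the normal closure of the single commutator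
`⁅a, b⁆`. Here `K` contains the image of `φ`, so invariance of `S` under conjugation by `K`
suffices. -/
lemma derivedSeries_one_le_of_closure_pair_eq_top {Γ G : Type*} [Group Γ] [Group G] (φ : Γ →* G)
    {a b : Γ} (hab : Subgroup.closure {a, b} = ⊤) {K S : Subgroup G} (ha : φ a ∈ K) (hb : φ b ∈ K)
    (hS : ∀ g ∈ K, ∀ s ∈ S, g * s * g⁻¹ ∈ S) (h : ⁅φ a, φ b⁆ ∈ S) :
    derivedSeries Γ 1 ≤ S.comap φ := by
  have hK : ∀ x : Γ, φ x ∈ K := by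
    have : Subgroup.closure {a, b} ≤ K.comap φ := by
      rw [Subgroup.closure_le]
      rintro x (rfl | rfl)
      · exact ha
      · exact hb
    intro x
    exact this (hab ▸ Subgroup.mem_top x)
  have key : ∀ x y : Γ, φ ⁅x, y⁆ ∈ S := by
    have mul_left : ∀ x y z : Γ, φ ⁅x, z⁆ ∈ S → φ ⁅y, z⁆ ∈ S → φ ⁅x * y, z⁆ ∈ S := by
      intro x y z hx hy
      have : ⁅x * y, z⁆ = x * ⁅y, z⁆ * x⁻¹ * ⁅x, z⁆ := by
        simp only [commutatorElement_def]; group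
      rw [this, map_mul, map_mul, map_mul, map_inv]
      exact mul_mem (hS _ (hK x) _ hy) hx
    have inv_left : ∀ x z : Γ, φ ⁅x, z⁆ ∈ S → φ ⁅x⁻¹, z⁆ ∈ S := by
      intro x z hx
      have : ⁅x⁻¹, z⁆ = x⁻¹ * ⁅x, z⁆⁻¹ * x⁻¹⁻¹ := by
        simp only [commutatorElement_def]; group
      rw [this, map_mul, map_mul, map_inv φ x⁻¹, map_inv φ ⁅x, z⁆]
      exact hS _ (hK _) _ (inv_mem hx)
    have symm : ∀ x z : Γ, φ ⁅x, z⁆ ∈ S → φ ⁅z, x⁆ ∈ S := by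
      intro x z hx
      rw [← commutatorElement_inv, map_inv]
      exact inv_mem hx
    intro x y
    refine Subgroup.closure_induction₂ (k := {a, b}) (p := fun x y _ _ => φ ⁅x, y⁆ ∈ S)
      ?_ ?_ ?_ ?_ ?_ ?_ ?_ (hab ▸ Subgroup.mem_top x) (hab ▸ Subgroup.mem_top y)
    · have h1 : φ ⁅a, b⁆ ∈ S := by rwa [map_commutatorElement]
      rintro x y (rfl | rfl) (rfl | rfl)
      · simp
      · exact h1
      · exact symm _ _ h1
      · simp
    · intro x _; simp
    · intro x _; simp
    · intro x y z _ _ _ hx hy; exact mul_left x y z hx hy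
    · intro y z x _ _ _ hy hz
      exact symm _ _ (mul_left y z x (symm _ _ hy) (symm _ _ hz))
    · intro x y _ _ hx; exact inv_left x y hx
    · intro x y _ _ hx; exact symm _ _ (inv_left y x (symm _ _ hx))
  rw [derivedSeries_succ, Subgroup.commutator_le]
  intro x _ y _
  exact key x y

variable {n : ℕ} {F : Type*} [Field F] {Γ : Type*} [Group Γ]

/-- Modulo depth 4, conjugating a multiple of `C = nilPart ⁅φ a, φ b⁆` only adds combinations of
`[X, C]` and `[Y, C]`, because conjugating elements are combinations of `X` and `Y` modulo depth 2.
-/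
lemma exists_matrices_derivedSeries_one (φ : Γ →* unitriangular n F) {a b : Γ}
    (hab : Subgroup.closure {a, b} = ⊤) :
    ∃ C ∈ band n F 2, ∃ C₁ ∈ band n F 3, ∃ C₂ ∈ band n F 3, ∀ g ∈ derivedSeries Γ 1,
      ∃ s s₁ s₂ : F, nilPart (φ g) - (s • C + s₁ • C₁ + s₂ • C₂) ∈ band n F 4 := by
  obtain ⟨X, hX⟩ : ∃ X, X = nilPart (φ a) := ⟨_, rfl⟩
  obtain ⟨Y, hY⟩ : ∃ Y, Y = nilPart (φ b) := ⟨_, rfl⟩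
  obtain ⟨C, hC⟩ : ∃ C, C = nilPart ⁅φ a, φ b⁆ := ⟨_, rfl⟩
  have mX : X ∈ band n F 1 := hX ▸ nilPart_mem_band_one _
  have mY : Y ∈ band n F 1 := hY ▸ nilPart_mem_band_one _
  have mC : C ∈ band n F 2 := hC ▸ nilPart_commutator_mem (nilPart_mem_band_one _)
    (nilPart_mem_band_one _) le_rfl
  have mC₁ : X * C - C * X ∈ band n F 3 := band_lie_mem_of_le mX mC (by omega)
  have mC₂ : Y * C - C * Y ∈ band n F 3 := band_lie_mem_of_le mY mC (by omega)
  let K : Subgroup (unitriangular n F) := bandSubgroup (Submodule.span F {X, Y} ⊔ band n F 2) 1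
    (le_sup_right) (sup_le (Submodule.span_le.2 (by
      rintro x (rfl | rfl)
      · exact mX
      · exact mY)) (band_anti (by omega)))
  let S : Subgroup (unitriangular n F) :=
    bandSubgroup (Submodule.span F {C, X * C - C * X, Y * C - C * Y} ⊔ band n F 4) 2
    (le_sup_right) (sup_le (Submodule.span_le.2 (by
      rintro x (rfl | rfl | rfl)
      · exact mC
      · exact band_anti (by omega) mC₁
      · exact band_anti (by omega) mC₂)) (band_anti (by omega)))
  have hle : derivedSeries Γ 1 ≤ S.comap φ := by
    refine derivedSeries_one_le_of_closure_pair_eq_top φ hab (K := K) ?_ ?_ ?_ ?_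
    · exact Submodule.mem_sup_left (hX ▸ Submodule.subset_span (by simp))
    · exact Submodule.mem_sup_left (hY ▸ Submodule.subset_span (by simp))
    · intro g hg s hs
      have hc : g * s * g⁻¹ = ⁅g, s⁆ * s := by simp [commutatorElement_def]
      rw [hc]
      refine mul_mem ?_ hs
      obtain ⟨x, hx, w, hw, hxw⟩ := Submodule.mem_sup.1 hg
      obtain ⟨y, hy, v, hv, hyv⟩ := Submodule.mem_sup.1 hs
      obtain ⟨p, q, rfl⟩ := Submodule.mem_span_pair.1 hx
      obtain ⟨t, t₁, t₂, rfl⟩ := Submodule.mem_span_triple.1 hy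
      have h2 : nilPart s ∈ band n F 2 := by
        rw [← hyv]
        exact add_mem (add_mem (add_mem (Submodule.smul_mem _ _ mC)
          (Submodule.smul_mem _ _ (band_anti (by omega) mC₁)))
          (Submodule.smul_mem _ _ (band_anti (by omega) mC₂))) (band_anti (by omega) hv)
      have h3 := nilPart_commutator_sub_mem (nilPart_mem_band_one g) h2 (m := 4) (by omega)
      have mx : p • X + q • Y ∈ band n F 1 :=
        add_mem (Submodule.smul_mem _ _ mX) (Submodule.smul_mem _ _ mY)
      have mv : t₁ • (X * C - C * X) + t₂ • (Y * C - C * Y) + v ∈ band n F 3 :=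
        add_mem (add_mem (Submodule.smul_mem _ _ mC₁) (Submodule.smul_mem _ _ mC₂))
          (band_anti (by omega) hv)
      -- Only the depth 1 part of `g` against the `C` part of `s` matters; all remaining brackets
      -- have depth at least 4.
      have h4 : nilPart g * nilPart s - nilPart s * nilPart g =
          (t * p) • (X * C - C * X) + (t * q) • (Y * C - C * Y) +
          ((w * nilPart s - nilPart s * w) +
          ((p • X + q • Y) * (t₁ • (X * C - C * X) + t₂ • (Y * C - C * Y) + v) -
            (t₁ • (X * C - C * X) + t₂ • (Y * C - C * Y) + v) * (p • X + q • Y))) := by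
        have hyv' : nilPart s =
            t • C + (t₁ • (X * C - C * X) + t₂ • (Y * C - C * Y) + v) := by
          rw [← hyv]; abel
        rw [hyv', ← hxw]
        generalize t₁ • (X * C - C * X) + t₂ • (Y * C - C * Y) + v = V
        simp only [mul_add, add_mul, smul_mul_assoc, mul_smul_comm]
        module
      rw [mem_bandSubgroup]
      rw [← sub_add_cancel (nilPart ⁅g, s⁆) (nilPart g * nilPart s - nilPart s * nilPart g)]
      refine add_mem (Submodule.mem_sup_right h3) ?_
      rw [h4]
      refine add_mem (Submodule.mem_sup_left ?_) (Submodule.mem_sup_right ?_)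
      · exact add_mem (Submodule.smul_mem _ _ (Submodule.subset_span (by simp)))
          (Submodule.smul_mem _ _ (Submodule.subset_span (by simp)))
      · exact add_mem (band_lie_mem_of_le hw h2 (by omega)) (band_lie_mem_of_le mx mv (by omega))
    · exact Submodule.mem_sup_left (hC ▸ Submodule.subset_span (by simp))
  refine ⟨C, mC, _, mC₁, _, mC₂, fun g hg => ?_⟩
  obtain ⟨y, hy, v, hv, hyv⟩ := Submodule.mem_sup.1 (hle hg)
  obtain ⟨t, t₁, t₂, rfl⟩ := Submodule.mem_span_triple.1 hy
  refine ⟨t, t₁, t₂, ?_⟩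
  rw [← hyv]
  simpa using hv

/-- As `[C, C] = 0`, nothing survives in degree 4; the degree 5 part comes from `[C, C₁]` and `[C,
C₂]`, while `[C₁, C₂]` already has depth 6. -/
lemma derivedSeries_le_of_span_triple {φ : Γ →* unitriangular n F}
    {C C₁ C₂ : Matrix (Fin n) (Fin n) F} (mC : C ∈ band n F 2) (mC₁ : C₁ ∈ band n F 3)
    (mC₂ : C₂ ∈ band n F 3) (h : ∀ g ∈ derivedSeries Γ 1, ∃ s s₁ s₂ : F,
      nilPart (φ g) - (s • C + s₁ • C₁ + s₂ • C₂) ∈ band n F 4) :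
    ∃ E₁ ∈ band n F 5, ∃ E₂ ∈ band n F 5, ∀ g ∈ derivedSeries Γ 2,
      ∃ s₁ s₂ : F, nilPart (φ g) - (s₁ • E₁ + s₂ • E₂) ∈ band n F 6 := by
  have mE₁ : C * C₁ - C₁ * C ∈ band n F 5 := band_lie_mem_of_le mC mC₁ (by omega)
  have mE₂ : C * C₂ - C₂ * C ∈ band n F 5 := band_lie_mem_of_le mC mC₂ (by omega)
  let S : Subgroup (unitriangular n F) :=
    bandSubgroup (Submodule.span F {C * C₁ - C₁ * C, C * C₂ - C₂ * C} ⊔ band n F 6) 5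
    ((band_anti (by omega)).trans le_sup_right) (sup_le (Submodule.span_le.2 (by
      rintro x (rfl | rfl)
      · exact mE₁
      · exact mE₂)) (band_anti (by omega)))
  refine ⟨_, mE₁, _, mE₂, ?_⟩
  have hle : derivedSeries Γ 2 ≤ S.comap φ := by
    rw [derivedSeries_succ, Subgroup.commutator_le]
    intro g hg k hk
    obtain ⟨s, s₁, s₂, hs⟩ := h g hg
    obtain ⟨t, t₁, t₂, ht⟩ := h k hk
    obtain ⟨v, hv⟩ : ∃ v, v = nilPart (φ g) - (s • C + s₁ • C₁ + s₂ • C₂) := ⟨_, rfl⟩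
    obtain ⟨w, hw⟩ : ∃ w, w = nilPart (φ k) - (t • C + t₁ • C₁ + t₂ • C₂) := ⟨_, rfl⟩
    rw [← hv] at hs
    rw [← hw] at ht
    have hx : nilPart (φ g) = s • C + (s₁ • C₁ + s₂ • C₂) + v := by rw [hv]; abel
    have hy : nilPart (φ k) = t • C + (t₁ • C₁ + t₂ • C₂) + w := by rw [hw]; abel
    have mP : s₁ • C₁ + s₂ • C₂ ∈ band n F 3 :=
      add_mem (Submodule.smul_mem _ _ mC₁) (Submodule.smul_mem _ _ mC₂)
    have mQ : t₁ • C₁ + t₂ • C₂ ∈ band n F 3 :=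
      add_mem (Submodule.smul_mem _ _ mC₁) (Submodule.smul_mem _ _ mC₂)
    have mx : nilPart (φ g) ∈ band n F 2 := by
      rw [hx]
      exact add_mem (add_mem (Submodule.smul_mem _ _ mC) (band_anti (by omega) mP))
        (band_anti (by omega) hs)
    have my : nilPart (φ k) ∈ band n F 2 := by
      rw [hy]
      exact add_mem (add_mem (Submodule.smul_mem _ _ mC) (band_anti (by omega) mQ))
        (band_anti (by omega) ht)
    have h3 := nilPart_commutator_sub_mem mx my (m := 6) (by omega)
    have h4 : nilPart (φ g) * nilPart (φ k) - nilPart (φ k) * nilPart (φ g) =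
        (s * t₁ - t * s₁) • (C * C₁ - C₁ * C) + (s * t₂ - t * s₂) • (C * C₂ - C₂ * C) +
        (((s₁ • C₁ + s₂ • C₂) * (t₁ • C₁ + t₂ • C₂) -
          (t₁ • C₁ + t₂ • C₂) * (s₁ • C₁ + s₂ • C₂)) +
        ((nilPart (φ g) - v) * w - w * (nilPart (φ g) - v)) +
        (v * nilPart (φ k) - nilPart (φ k) * v)) := by
      rw [hx, hy]
      simp only [add_sub_cancel_right, mul_add, add_mul, smul_mul_assoc, mul_smul_comm]
      module
    rw [Subgroup.mem_comap, map_commutatorElement, mem_bandSubgroup]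
    rw [← sub_add_cancel (nilPart ⁅φ g, φ k⁆)
      (nilPart (φ g) * nilPart (φ k) - nilPart (φ k) * nilPart (φ g))]
    refine add_mem (Submodule.mem_sup_right h3) ?_
    rw [h4]
    refine add_mem (Submodule.mem_sup_left ?_) (Submodule.mem_sup_right ?_)
    · exact add_mem (Submodule.smul_mem _ _ (Submodule.subset_span (by simp)))
        (Submodule.smul_mem _ _ (Submodule.subset_span (by simp)))
    · exact add_mem (add_mem (band_lie_mem_of_le mP mQ (by omega))
        (band_lie_mem_of_le (sub_mem mx (band_anti (by omega) hs)) ht (by omega)))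
        (band_lie_mem_of_le hs my (by omega))
  intro g hg
  obtain ⟨y, hy, v, hv, hyv⟩ := Submodule.mem_sup.1 (hle hg)
  obtain ⟨t₁, t₂, rfl⟩ := Submodule.mem_span_pair.1 hy
  refine ⟨t₁, t₂, ?_⟩
  rw [← hyv]
  simpa using hv

/-- The exterior square of a plane is a line, spanned here by `[E₁, E₂]`. -/
lemma derivedSeries_succ_of_span_pair {φ : Γ →* unitriangular n F} {d k : ℕ} (hk : 1 ≤ k)
    {E₁ E₂ : Matrix (Fin n) (Fin n) F} (mE₁ : E₁ ∈ band n F k) (mE₂ : E₂ ∈ band n F k)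
    (h : ∀ g ∈ derivedSeries Γ d, ∃ s₁ s₂ : F,
      nilPart (φ g) - (s₁ • E₁ + s₂ • E₂) ∈ band n F (k + 1)) :
    ∃ D ∈ band n F (2 * k), ∀ g ∈ derivedSeries Γ (d + 1),
      ∃ s : F, nilPart (φ g) - s • D ∈ band n F (2 * k + 1) := by
  have mD : E₁ * E₂ - E₂ * E₁ ∈ band n F (2 * k) := band_lie_mem_of_le mE₁ mE₂ (by omega)
  let S : Subgroup (unitriangular n F) :=
    bandSubgroup (Submodule.span F {E₁ * E₂ - E₂ * E₁} ⊔ band n F (2 * k + 1)) (2 * k)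
    ((band_anti (by omega)).trans le_sup_right) (sup_le (Submodule.span_le.2 (by
      rintro x rfl
      exact mD)) (band_anti (by omega)))
  refine ⟨_, mD, ?_⟩
  have hle : derivedSeries Γ (d + 1) ≤ S.comap φ := by
    rw [derivedSeries_succ, Subgroup.commutator_le]
    intro g hg u hu
    obtain ⟨s₁, s₂, hs⟩ := h g hg
    obtain ⟨t₁, t₂, ht⟩ := h u hu
    obtain ⟨v, hv⟩ : ∃ v, v = nilPart (φ g) - (s₁ • E₁ + s₂ • E₂) := ⟨_, rfl⟩
    obtain ⟨w, hw⟩ : ∃ w, w = nilPart (φ u) - (t₁ • E₁ + t₂ • E₂) := ⟨_, rfl⟩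
    rw [← hv] at hs
    rw [← hw] at ht
    have hx : nilPart (φ g) = s₁ • E₁ + s₂ • E₂ + v := by rw [hv]; abel
    have hy : nilPart (φ u) = t₁ • E₁ + t₂ • E₂ + w := by rw [hw]; abel
    have mx : nilPart (φ g) ∈ band n F k := by
      rw [hx]
      exact add_mem (add_mem (Submodule.smul_mem _ _ mE₁) (Submodule.smul_mem _ _ mE₂))
        (band_anti (by omega) hs)
    have my : nilPart (φ u) ∈ band n F k := by
      rw [hy]
      exact add_mem (add_mem (Submodule.smul_mem _ _ mE₁) (Submodule.smul_mem _ _ mE₂))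
        (band_anti (by omega) ht)
    have h3 := nilPart_commutator_sub_mem mx my (m := 2 * k + 1) (by omega)
    have h4 : nilPart (φ g) * nilPart (φ u) - nilPart (φ u) * nilPart (φ g) =
        (s₁ * t₂ - t₁ * s₂) • (E₁ * E₂ - E₂ * E₁) +
        (((nilPart (φ g) - v) * w - w * (nilPart (φ g) - v)) +
        (v * nilPart (φ u) - nilPart (φ u) * v)) := by
      rw [hx, hy]
      simp only [add_sub_cancel_right, mul_add, add_mul, smul_mul_assoc, mul_smul_comm]
      module
    rw [Subgroup.mem_comap, map_commutatorElement, mem_bandSubgroup]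
    rw [← sub_add_cancel (nilPart ⁅φ g, φ u⁆)
      (nilPart (φ g) * nilPart (φ u) - nilPart (φ u) * nilPart (φ g))]
    refine add_mem (Submodule.mem_sup_right h3) ?_
    rw [h4]
    refine add_mem (Submodule.mem_sup_left ?_) (Submodule.mem_sup_right ?_)
    · exact Submodule.smul_mem _ _ (Submodule.subset_span (by simp))
    · exact add_mem
        (band_lie_mem_of_le (sub_mem mx (band_anti (by omega) hs)) ht (by omega))
        (band_lie_mem_of_le hs my (by omega))
  intro g hg
  obtain ⟨y, hy, v, hv, hyv⟩ := Submodule.mem_sup.1 (hle hg)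
  obtain ⟨t, rfl⟩ := Submodule.mem_span_singleton.1 hy
  refine ⟨t, ?_⟩
  rw [← hyv]
  simpa using hv

/-- A line has zero exterior square, which gains one degree beyond doubling: from depth 10 this
yields 21. -/
lemma derivedSeries_succ_le_of_span_singleton {φ : Γ →* unitriangular n F} {d k : ℕ}
    {D : Matrix (Fin n) (Fin n) F} (mD : D ∈ band n F k)
    (h : ∀ g ∈ derivedSeries Γ d, ∃ s : F, nilPart (φ g) - s • D ∈ band n F (k + 1)) :
    derivedSeries Γ (d + 1) ≤ (bandLevel n F (2 * k + 1)).comap φ := by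
  rw [derivedSeries_succ, Subgroup.commutator_le]
  intro g hg u hu
  obtain ⟨s, hs⟩ := h g hg
  obtain ⟨t, ht⟩ := h u hu
  obtain ⟨v, hv⟩ : ∃ v, v = nilPart (φ g) - s • D := ⟨_, rfl⟩
  obtain ⟨w, hw⟩ : ∃ w, w = nilPart (φ u) - t • D := ⟨_, rfl⟩
  rw [← hv] at hs
  rw [← hw] at ht
  have hx : nilPart (φ g) = s • D + v := by rw [hv]; abel
  have hy : nilPart (φ u) = t • D + w := by rw [hw]; abel
  have mx : nilPart (φ g) ∈ band n F k := by
    rw [hx]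
    exact add_mem (Submodule.smul_mem _ _ mD) (band_anti (by omega) hs)
  have my : nilPart (φ u) ∈ band n F k := by
    rw [hy]
    exact add_mem (Submodule.smul_mem _ _ mD) (band_anti (by omega) ht)
  have h3 := nilPart_commutator_sub_mem mx my (m := 2 * k + 1) (by omega)
  have h4 : nilPart (φ g) * nilPart (φ u) - nilPart (φ u) * nilPart (φ g) =
      ((nilPart (φ g) - v) * w - w * (nilPart (φ g) - v)) +
      (v * nilPart (φ u) - nilPart (φ u) * v) := by
    rw [hx, hy]
    simp only [add_sub_cancel_right, mul_add, add_mul, smul_mul_assoc, mul_smul_comm]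
    module
  rw [Subgroup.mem_comap, map_commutatorElement, mem_bandLevel]
  rw [← sub_add_cancel (nilPart ⁅φ g, φ u⁆)
    (nilPart (φ g) * nilPart (φ u) - nilPart (φ u) * nilPart (φ g))]
  refine add_mem h3 ?_
  rw [h4]
  exact (add_mem
    (band_lie_mem_of_le (sub_mem mx (band_anti (by omega) hs)) ht (by omega))
    (band_lie_mem_of_le hs my (by omega)))

/-- The `d`-th derived subgroup of a two-generated group of unitriangular matrices lies in the
band of width `⌊21 · 2 ^ d / 16⌋`. -/
lemma derivedSeries_le_bandLevel_of_closure_pair_eq_top (φ : Γ →* unitriangular n F) {a b : Γ}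
    (hab : Subgroup.closure {a, b} = ⊤) (d : ℕ) :
    derivedSeries Γ d ≤ (bandLevel n F (21 * 2 ^ d / 16)).comap φ := by
  obtain ⟨C, mC, C₁, mC₁, C₂, mC₂, h1⟩ := exists_matrices_derivedSeries_one φ hab
  obtain ⟨E₁, mE₁, E₂, mE₂, h2⟩ := derivedSeries_le_of_span_triple mC mC₁ mC₂ h1
  obtain ⟨D, mD, h3⟩ := derivedSeries_succ_of_span_pair (by omega) mE₁ mE₂ h2
  match d with
  | 0 => exact fun g _ => nilPart_mem_band_one _
  | 1 =>
    intro g hg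
    obtain ⟨s, s₁, s₂, h⟩ := h1 g hg
    have h5 := add_mem (band_anti (k := 2) (by omega) h) (add_mem (add_mem
      (Submodule.smul_mem _ s mC) (Submodule.smul_mem _ s₁ (band_anti (by omega) mC₁)))
      (Submodule.smul_mem _ s₂ (band_anti (by omega) mC₂)))
    rwa [sub_add_cancel] at h5
  | 2 =>
    intro g hg
    obtain ⟨s₁, s₂, h⟩ := h2 g hg
    have h5 := add_mem (band_anti (k := 5) (by omega) h) (add_mem
      (Submodule.smul_mem _ s₁ mE₁) (Submodule.smul_mem _ s₂ mE₂))
    rwa [sub_add_cancel] at h5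
  | 3 =>
    intro g hg
    obtain ⟨s, h⟩ := h3 g hg
    have h5 := add_mem (band_anti (k := 10) (by omega) h) (Submodule.smul_mem _ s mD)
    rwa [sub_add_cancel] at h5
  | e + 4 =>
    have h4 := derivedSeries_le_bandLevel_two_pow_mul φ
      (derivedSeries_succ_le_of_span_singleton mD h3) e
    -- From `d = 4` on the division by 16 is exact and depth merely doubles.
    have h5 : 21 * 2 ^ (e + 4) / 16 = (2 * (2 * 5) + 1) * 2 ^ e := by
      rw [pow_add]; omega
    rwa [h5, add_comm e 4]

lemma derivedSeries_closure_pair_eq_bot (a b : unitriangular n F) {d : ℕ}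
    (h : n ≤ 21 * 2 ^ d / 16) :
    derivedSeries (Subgroup.closure {a, b} : Subgroup (unitriangular n F)) d = ⊥ := by
  set H := Subgroup.closure {a, b} with hH
  have ha : a ∈ H := Subgroup.subset_closure (by simp)
  have hb : b ∈ H := Subgroup.subset_closure (by simp)
  have htop : Subgroup.closure {(⟨a, ha⟩ : H), ⟨b, hb⟩} = ⊤ := by
    rw [← Subgroup.closure_closure_coe_preimage (k := {a, b})]
    congr 1
    ext x
    simp only [Set.mem_preimage, Set.mem_insert_iff, Set.mem_singleton_iff, Subtype.ext_iff]
  exact derivedSeries_eq_bot_of_le_bandLevel H.subtype_injective h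
    (derivedSeries_le_bandLevel_of_closure_pair_eq_top H.subtype htop d)

end TwoGenerated

/-! ### Lower bound: Lie polynomials evaluated along words. -/

section LiePolynomials

open scoped commutatorElement

/-- The generator `X` (for `c = true`) or `Y` (for `c = false`) of the free associative algebra,
as a function on words reading off the first letter. -/
def letterPoly (c : Bool) : List Bool → ℤ
  | [] => 0
  | c' :: _ => if c' = c then 1 else 0

/-- The commutator of a polynomial `f` of degree `k` and a polynomial `g` of degree `l` in two
noncommuting variables; a homogeneous polynomial is given by its coefficients, as a function on
words that depends only on an initial segment. -/
def polyBracket (k l : ℕ) (f g : List Bool → ℤ) (w : List Bool) : ℤ :=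
  f w * g (w.drop k) - g w * f (w.drop l)

/-- `IsDerivedLiePoly d k f`: `f` is a Lie monomial of degree `k` in `X` and `Y` lying in the
`d`-th derived subalgebra. -/
inductive IsDerivedLiePoly : ℕ → ℕ → (List Bool → ℤ) → Prop
  | letter (c : Bool) : IsDerivedLiePoly 0 1 (letterPoly c)
  | bracket {d k l : ℕ} {f g : List Bool → ℤ} : IsDerivedLiePoly d k f → IsDerivedLiePoly d l g →
      IsDerivedLiePoly (d + 1) (k + l) (polyBracket k l f g)
  | of_succ {d k : ℕ} {f : List Bool → ℤ} : IsDerivedLiePoly (d + 1) k f → IsDerivedLiePoly d k f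

/-- `M` vanishes below the `k`-th superdiagonal, on which its entries are the coefficients of `f`
at the subwords of `s`. -/
def RepresentsPoly {n : ℕ} {F : Type*} [Field F] (s : List Bool) (k : ℕ) (f : List Bool → ℤ)
    (M : Matrix (Fin n) (Fin n) F) : Prop :=
  M ∈ band n F k ∧ ∀ i j : Fin n, (j : ℕ) = i + k → M i j = ((f (s.drop i) : ℤ) : F)

variable {n : ℕ} {F : Type*} [Field F]

lemma band_mul_apply {k l : ℕ} {M N : Matrix (Fin n) (Fin n) F} (hM : M ∈ band n F k)
    (hN : N ∈ band n F l) {i m j : Fin n} (hm : (m : ℕ) = i + k) (hj : (j : ℕ) = i + (k + l)) :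
    (M * N) i j = M i m * N m j := by
  rw [Matrix.mul_apply]
  refine Finset.sum_eq_single m (fun b _ hb => ?_) (by simp)
  rcases lt_or_gt_of_ne hb with h | h
  · rw [hM i b (by rw [← hm]; exact h), zero_mul]
  · rw [hN b j (by have := Fin.lt_def.1 h; omega), mul_zero]

lemma RepresentsPoly.polyBracket {s : List Bool} {k l : ℕ} {f g : List Bool → ℤ}
    {M N : Matrix (Fin n) (Fin n) F} (hM : RepresentsPoly s k f M) (hN : RepresentsPoly s l g N) :
    RepresentsPoly s (k + l) (polyBracket k l f g) (M * N - N * M) := by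
  refine ⟨band_lie_mem_of_le hM.1 hN.1 le_rfl, fun i j hij => ?_⟩
  have hk : (i : ℕ) + k < n := by omega
  have hl : (i : ℕ) + l < n := by omega
  rw [Matrix.sub_apply, band_mul_apply hM.1 hN.1 (m := ⟨i + k, hk⟩) rfl hij,
    band_mul_apply hN.1 hM.1 (m := ⟨i + l, hl⟩) rfl (by omega),
    hM.2 i ⟨i + k, hk⟩ rfl, hN.2 i ⟨i + l, hl⟩ rfl, hM.2 ⟨i + l, hl⟩ j (by simp only; omega),
    hN.2 ⟨i + k, hk⟩ j (by simp only; omega)]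
  simp [_root_.polyBracket, List.drop_drop]

lemma RepresentsPoly.of_sub_mem {s : List Bool} {k : ℕ} {f : List Bool → ℤ}
    {M N : Matrix (Fin n) (Fin n) F} (hM : RepresentsPoly s k f M)
    (h : N - M ∈ band n F (k + 1)) : RepresentsPoly s k f N := by
  refine ⟨by simpa using add_mem (band_anti (Nat.le_succ k) h) hM.1, fun i j hij => ?_⟩
  rw [← hM.2 i j hij, ← sub_eq_zero, ← Matrix.sub_apply]
  exact h i j (by omega)

lemma exists_representsPoly_letterPoly (s : List Bool) (c : Bool) :
    ∃ u : unitriangular n F, RepresentsPoly s 1 (letterPoly c) (nilPart u) := by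
  let N : Matrix (Fin n) (Fin n) F := Matrix.of fun i j =>
    if (j : ℕ) = i + 1 then ((letterPoly c (s.drop i) : ℤ) : F) else 0
  have hN : N ∈ band n F 1 := fun i j hij => by
    simp only [N, Matrix.of_apply]
    rw [if_neg (by omega)]
  obtain ⟨u, hu⟩ := exists_nilPart_eq hN
  refine ⟨u, hu ▸ hN, fun i j hij => ?_⟩
  rw [hu]
  simp only [N, Matrix.of_apply]
  rw [if_pos hij]

/-- Replacing Lie brackets by group commutators in the monomial produces an element of the derived
series whose leading superdiagonal is the evaluated polynomial. -/
lemma IsDerivedLiePoly.exists_representsPoly {Γ : Type*} [Group Γ] (φ : Γ →* unitriangular n F)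
    {s : List Bool} (hs : ∀ c, ∃ x : Γ, RepresentsPoly s 1 (letterPoly c) (nilPart (φ x)))
    {d k : ℕ} {f : List Bool → ℤ} (hf : IsDerivedLiePoly d k f) :
    ∃ g ∈ derivedSeries Γ d, RepresentsPoly s k f (nilPart (φ g)) := by
  induction hf with
  | letter c =>
    obtain ⟨x, hx⟩ := hs c
    exact ⟨x, Subgroup.mem_top x, hx⟩
  | bracket _ _ ihf ihg =>
    obtain ⟨x, hx, hx'⟩ := ihf
    obtain ⟨y, hy, hy'⟩ := ihg
    refine ⟨⁅x, y⁆, Subgroup.commutator_mem_commutator hx hy, ?_⟩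
    refine (hx'.polyBracket hy').of_sub_mem ?_
    rw [map_commutatorElement]
    exact nilPart_commutator_sub_mem hx'.1 hy'.1 (by omega)
  | of_succ _ ih =>
    obtain ⟨x, hx, hx'⟩ := ih
    exact ⟨x, derivedSeries_antitone Γ (Nat.le_succ _) hx, hx'⟩

/-- Three polynomials of degree `k` and three words of length `k` whose matrix of coefficients is
triangular and invertible. -/
def IsTriangularTriple (k : ℕ) (f : Fin 3 → List Bool → ℤ) (u : Fin 3 → List Bool) : Prop :=
  (∀ i, (u i).length = k) ∧ ∃ m : Fin 3 → Fin 3 → ℤ, (∀ i j t, f i (u j ++ t) = m i j) ∧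
    (∀ i j, j < i → m i j = 0) ∧ ∀ i, IsUnit (m i i)

/-- The coefficients of the three pairwise brackets at the concatenated words are the 2 × 2 minors
of the old matrix. The second compound of an invertible triangular matrix is again triangular, with
products of old diagonal entries on the diagonal. -/
lemma IsTriangularTriple.exists_double {d k : ℕ} {f : Fin 3 → List Bool → ℤ}
    {u : Fin 3 → List Bool} (h : IsTriangularTriple k f u) (hf : ∀ i, IsDerivedLiePoly d k (f i)) :
    ∃ g v, IsTriangularTriple (k + k) g v ∧ ∀ i, IsDerivedLiePoly (d + 1) (k + k) (g i) := by
  obtain ⟨hu, m, hm, hlow, hdiag⟩ := h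
  -- `(p, q)` lists the pairs `(0,1)`, `(0,2)`, `(1,2)` lexicographically, the order that preserves
  -- triangularity.
  let p : Fin 3 → Fin 3 := ![0, 0, 1]
  let q : Fin 3 → Fin 3 := ![1, 2, 2]
  refine ⟨fun i => polyBracket k k (f (p i)) (f (q i)), fun j => u (p j) ++ u (q j),
    ⟨fun i => by simp [hu], fun i j => m (p i) (p j) * m (q i) (q j) - m (q i) (p j) * m (p i) (q j),
      fun i j t => ?_, fun i j hij => ?_, fun i => ?_⟩, fun i => (hf _).bracket (hf _)⟩
  · simp only [polyBracket, List.append_assoc]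
    rw [List.drop_left' (hu (p j)), hm, hm, hm, hm]
  · have h10 := hlow 1 0 (by decide)
    have h20 := hlow 2 0 (by decide)
    have h21 := hlow 2 1 (by decide)
    fin_cases i <;> fin_cases j <;> simp [p, q, h10, h20, h21] at hij ⊢
  · have h10 := hlow 1 0 (by decide)
    have h20 := hlow 2 0 (by decide)
    have h21 := hlow 2 1 (by decide)
    have h00 := hdiag 0
    have h11 := hdiag 1
    have h22 := hdiag 2
    fin_cases i
    · simpa [p, q, h10, h20, h21] using h00.mul h11
    · simpa [p, q, h10, h20, h21] using h00.mul h22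
    · simpa [p, q, h10, h20, h21] using h11.mul h22

lemma IsDerivedLiePoly.of_eq_degree {d k l : ℕ} {f : List Bool → ℤ} (h : IsDerivedLiePoly d k f)
    (hkl : k = l) : IsDerivedLiePoly d l f := hkl ▸ h

/-- `[X, Y]` -/
def lieXY : List Bool → ℤ := polyBracket 1 1 (letterPoly true) (letterPoly false)

/-- `[c, [X, Y]]` for a letter `c` -/
def lieThree (c : Bool) : List Bool → ℤ := polyBracket 1 2 (letterPoly c) lieXY

/-- `[X, [c, [X, Y]]]` for a letter `c` -/
def lieFour (c : Bool) : List Bool → ℤ := polyBracket 1 3 (letterPoly true) (lieThree c)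

/-- `[[X, Y], [c, [X, Y]]]` for a letter `c` -/
def lieFive (c : Bool) : List Bool → ℤ := polyBracket 2 3 lieXY (lieThree c)

/-- `[[X, Y], [X, [c, [X, Y]]]]` for a letter `c` -/
def lieSix (c : Bool) : List Bool → ℤ := polyBracket 2 4 lieXY (lieFour c)

/-- The commutator of the two elements `lieFive` -/
def lieTen : List Bool → ℤ := polyBracket 5 5 (lieFive true) (lieFive false)

/-- A family of Lie monomials of degree `21` in the fourth derived subalgebra -/
def lieTwentyOne (c c' : Bool) : List Bool → ℤ :=
  polyBracket 10 11 lieTen (polyBracket 5 6 (lieFive c) (lieSix c'))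

lemma isDerivedLiePoly_lieXY : IsDerivedLiePoly 1 2 lieXY :=
  (IsDerivedLiePoly.letter true).bracket (IsDerivedLiePoly.letter false)

lemma isDerivedLiePoly_lieThree (c : Bool) : IsDerivedLiePoly 1 3 (lieThree c) :=
  (IsDerivedLiePoly.letter c).bracket isDerivedLiePoly_lieXY.of_succ

lemma isDerivedLiePoly_lieFour (c : Bool) : IsDerivedLiePoly 1 4 (lieFour c) :=
  (IsDerivedLiePoly.letter true).bracket (isDerivedLiePoly_lieThree c).of_succ

lemma isDerivedLiePoly_lieFive (c : Bool) : IsDerivedLiePoly 2 5 (lieFive c) :=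
  isDerivedLiePoly_lieXY.bracket (isDerivedLiePoly_lieThree c)

lemma isDerivedLiePoly_lieSix (c : Bool) : IsDerivedLiePoly 2 6 (lieSix c) :=
  isDerivedLiePoly_lieXY.bracket (isDerivedLiePoly_lieFour c)

lemma isDerivedLiePoly_lieTen : IsDerivedLiePoly 3 10 lieTen :=
  (isDerivedLiePoly_lieFive true).bracket (isDerivedLiePoly_lieFive false)

lemma isDerivedLiePoly_lieTwentyOne (c c' : Bool) : IsDerivedLiePoly 4 21 (lieTwentyOne c c') :=
  isDerivedLiePoly_lieTen.bracket
    ((isDerivedLiePoly_lieFive c).bracket (isDerivedLiePoly_lieSix c'))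

/-- Leading words of three of the Lie monomials `lieTwentyOne` -/
def leadingWord : Fin 3 → List Bool :=
  ![[true, true, true, false, true, false, true, true, false, true, false, true, true, false, true, false, true, false, true, false, false],
    [true, true, true, false, true, false, true, false, true, false, false, true, true, false, true, false, true, false, true, false, false],
    [true, true, false, true, false, true, true, false, false, true, false, true, true, false, true, false, true, false, true, false, false]]

lemma isTriangularTriple_lieTwentyOne : IsTriangularTriple 21
    ![lieTwentyOne true true, lieTwentyOne false true, lieTwentyOne true false] leadingWord := by
  refine ⟨by decide, fun i j => (![lieTwentyOne true true, lieTwentyOne false true,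
    lieTwentyOne true false] : Fin 3 → List Bool → ℤ) i (leadingWord j), ?_, ?_, ?_⟩
  · intro i j t
    -- A degree 21 polynomial reads only 21 letters, so the suffix `t` drops out by computation.
    fin_cases i <;> fin_cases j <;> rfl
  · decide +kernel
  · simp only [Int.isUnit_iff]
    decide +kernel

lemma exists_isTriangularTriple (e : ℕ) : ∃ f u, IsTriangularTriple (21 * 2 ^ e) f u ∧
    ∀ i, IsDerivedLiePoly (e + 4) (21 * 2 ^ e) (f i) := by
  induction e with
  | zero =>
    refine ⟨_, _, isTriangularTriple_lieTwentyOne, fun i => ?_⟩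
    fin_cases i
    · exact isDerivedLiePoly_lieTwentyOne true true
    · exact isDerivedLiePoly_lieTwentyOne false true
    · exact isDerivedLiePoly_lieTwentyOne true false
  | succ e ih =>
    obtain ⟨f, u, h, hf⟩ := ih
    obtain ⟨g, v, h', hg⟩ := h.exists_double hf
    have : 21 * 2 ^ (e + 1) = 21 * 2 ^ e + 21 * 2 ^ e := by ring
    rw [this, add_right_comm]
    exact ⟨g, v, h', hg⟩

lemma exists_isDerivedLiePoly_isUnit (d : ℕ) :
    ∃ f s, IsDerivedLiePoly d (21 * 2 ^ d / 16) f ∧ IsUnit (f s) := by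
  match d with
  | 0 => exact ⟨_, [true], IsDerivedLiePoly.letter true, isUnit_one⟩
  | 1 => exact ⟨_, [true, false], isDerivedLiePoly_lieXY, Int.isUnit_iff.2 (by decide +kernel)⟩
  | 2 => exact ⟨_, [true, true, false, true, false], isDerivedLiePoly_lieFive true,
      Int.isUnit_iff.2 (by decide +kernel)⟩
  | 3 => exact ⟨_, [true, true, false, true, false, true, false, true, false, false],
      isDerivedLiePoly_lieTen, Int.isUnit_iff.2 (by decide +kernel)⟩
  | e + 4 =>
    obtain ⟨f, u, ⟨-, m, hm, -, hdiag⟩, hf⟩ := exists_isTriangularTriple e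
    have h5 : 21 * 2 ^ e = 21 * 2 ^ (e + 4) / 16 := by
      rw [pow_add]; omega
    refine ⟨f 0, u 0, (hf 0).of_eq_degree h5, ?_⟩
    rw [← List.append_nil (u 0), hm]
    exact hdiag 0

/-- The matrices are read off from a word `s` where the coefficient of `f` is a unit; that
coefficient sits in the first row, in column `21 * 2 ^ d / 16`, which exists by `h`. -/
lemma exists_derivedSeries_closure_pair_ne_bot {d : ℕ} (h : 21 * 2 ^ d / 16 < n) :
    ∃ a b : unitriangular n F,
      derivedSeries (Subgroup.closure {a, b} : Subgroup (unitriangular n F)) d ≠ ⊥ := by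
  obtain ⟨f, s, hf, hs⟩ := exists_isDerivedLiePoly_isUnit d
  obtain ⟨a, ha⟩ := exists_representsPoly_letterPoly (n := n) (F := F) s true
  obtain ⟨b, hb⟩ := exists_representsPoly_letterPoly (n := n) (F := F) s false
  refine ⟨a, b, fun hbot => ?_⟩
  obtain ⟨g, hg, hgr⟩ := hf.exists_representsPoly (Subgroup.closure {a, b}).subtype (s := s) (by
    rintro (_ | _)
    · exact ⟨⟨b, Subgroup.subset_closure (by simp)⟩, hb⟩
    · exact ⟨⟨a, Subgroup.subset_closure (by simp)⟩, ha⟩)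
  rw [hbot, Subgroup.mem_bot] at hg
  have h1 := hgr.2 ⟨0, (Nat.zero_le _).trans_lt h⟩ ⟨_, h⟩ (Nat.zero_add _).symm
  rw [hg, map_one, nilPart_one, Matrix.zero_apply, List.drop_zero] at h1
  -- Being `±1`, the coefficient is nonzero in every characteristic.
  exact (hs.map (Int.castRingHom F)).ne_zero h1.symm

end LiePolynomials

section Criterion

variable {n : ℕ} {F : Type*} [Field F]

lemma exists_hasDerivedLength_closure_pair_iff {d : ℕ} (hd : n ≤ 2 ^ (d + 1)) :
    (∃ a b : unitriangular n F,
      HasDerivedLength (Subgroup.closure {a, b} : Subgroup (unitriangular n F)) (d + 1)) ↔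
      21 * 2 ^ d / 16 < n := by
  constructor
  · rintro ⟨a, b, h⟩
    by_contra! hn
    exact h.2 d (Nat.lt_succ_self d) (derivedSeries_closure_pair_eq_bot a b hn)
  · intro h
    obtain ⟨a, b, hab⟩ := exists_derivedSeries_closure_pair_ne_bot (F := F) h
    refine ⟨a, b, ?_, fun k hk hbot => hab ?_⟩
    · have := map_derivedSeries_le_derivedSeries (Subgroup.closure {a, b}).subtype (d + 1)
      rwa [derivedSeries_unitriangular_eq_bot hd, le_bot_iff, Subgroup.map_eq_bot_iff_of_injective
        _ (Subgroup.subtype_injective _)] at this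
    · exact le_bot_iff.1 (hbot ▸ derivedSeries_antitone _ (Nat.lt_succ_iff.1 hk))

/-- For `2 ^ d < n ≤ 2 ^ (d + 1)`, the unitriangular group has a two-generated subgroup of maximal
derived length exactly when `n > 21 · 2 ^ d / 16`. -/
lemma hasTwoGenSubgroupOfMaxDerivedLength_unitriangular_iff {d : ℕ} (h1 : 2 ^ d < n)
    (h2 : n ≤ 2 ^ (d + 1)) :
    HasTwoGenSubgroupOfMaxDerivedLength (unitriangular n F) ↔ 21 * 2 ^ d / 16 < n := by
  have hU : HasDerivedLength (unitriangular n F) (d + 1) :=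
    ⟨derivedSeries_unitriangular_eq_bot h2, fun k hk => derivedSeries_unitriangular_ne_bot
      ((Nat.pow_le_pow_right two_pos (Nat.lt_succ_iff.1 hk)).trans_lt h1)⟩
  rw [← exists_hasDerivedLength_closure_pair_iff (F := F) h2]
  constructor
  · rintro ⟨e, he, hab⟩
    rwa [he.unique hU] at hab
  · exact fun h => ⟨d + 1, hU, h⟩

lemma hasTwoGenSubgroupOfMaxDerivedLength_unitriangular_one :
    HasTwoGenSubgroupOfMaxDerivedLength (unitriangular 1 F) := by
  have : Subsingleton (unitriangular 1 F) :=
    ⟨fun a b => mul_inv_eq_one.1 (nilPart_eq_zero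
      (eq_zero_of_mem_band le_rfl (nilPart_mem_band_one (a * b⁻¹))))⟩
  exact ⟨0, ⟨Subsingleton.elim _ _, by simp⟩, 1, 1, Subsingleton.elim _ _, by simp⟩

end Criterion

/-! ### Counting good `n` and the limits of the proportion. -/

section Density

variable {p : ℕ → Prop} [DecidablePred p]

lemma card_filter_Icc_one_succ (N : ℕ) : ((Finset.Icc 1 (N + 1)).filter p).card =
    ((Finset.Icc 1 N).filter p).card + if p (N + 1) then 1 else 0 := by
  rw [← Finset.insert_Icc_right_eq_Icc_add_one (by omega), Finset.filter_insert]
  split_ifs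
  · rw [Finset.card_insert_of_notMem (by simp)]
  · simp

/-- Truncated subtraction encodes both regimes: no new good `n` up to the threshold, every `n` good
beyond it. -/
lemma card_filter_Icc_one_of_dyadic
    (hp : ∀ d n, 2 ^ d < n → n ≤ 2 ^ (d + 1) → (p n ↔ 21 * 2 ^ d / 16 < n)) {d N : ℕ}
    (h1 : 2 ^ d ≤ N) (h2 : N ≤ 2 ^ (d + 1)) : ((Finset.Icc 1 N).filter p).card =
      ((Finset.Icc 1 (2 ^ d)).filter p).card + (N - 21 * 2 ^ d / 16) := by
  induction N, h1 using Nat.le_induction with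
  | base =>
    have : 2 ^ d - 21 * 2 ^ d / 16 = 0 := by omega
    rw [this, Nat.add_zero]
  | succ N hN ih =>
    rw [card_filter_Icc_one_succ, ih (by omega)]
    have := hp d (N + 1) (by omega) h2
    by_cases h : p (N + 1)
    · rw [if_pos h]
      have := this.1 h
      omega
    · rw [if_neg h]
      have := mt this.2 h
      omega

/-- The constant 5 is attained at `d = 0`; 32 is exact for every `d ≥ 4`, where each dyadic block
adds exactly `11 * 2 ^ d / 16`. -/
lemma card_filter_Icc_one_two_pow (hp1 : p 1)
    (hp : ∀ d n, 2 ^ d < n → n ≤ 2 ^ (d + 1) → (p n ↔ 21 * 2 ^ d / 16 < n)) (d : ℕ) :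
    11 * 2 ^ d + 5 ≤ 16 * ((Finset.Icc 1 (2 ^ d)).filter p).card ∧
      16 * ((Finset.Icc 1 (2 ^ d)).filter p).card ≤ 11 * 2 ^ d + 32 := by
  have step : ∀ d, ((Finset.Icc 1 (2 ^ (d + 1))).filter p).card =
      ((Finset.Icc 1 (2 ^ d)).filter p).card + (2 ^ (d + 1) - 21 * 2 ^ d / 16) := fun d =>
    card_filter_Icc_one_of_dyadic hp (Nat.pow_le_pow_right two_pos (Nat.le_succ d)) le_rfl
  have h0 : ((Finset.Icc 1 (2 ^ 0)).filter p).card = 1 := by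
    simp [Finset.filter_singleton, hp1]
  have h1 : ((Finset.Icc 1 (2 ^ 1)).filter p).card = 2 := (step 0).trans (by rw [h0]; norm_num)
  have h2 : ((Finset.Icc 1 (2 ^ 2)).filter p).card = 4 := (step 1).trans (by rw [h1]; norm_num)
  have h3 : ((Finset.Icc 1 (2 ^ 3)).filter p).card = 7 := (step 2).trans (by rw [h2]; norm_num)
  have h4 : ((Finset.Icc 1 (2 ^ 4)).filter p).card = 13 := (step 3).trans (by rw [h3]; norm_num)
  have h5 : ∀ e, 16 * ((Finset.Icc 1 (2 ^ (e + 4))).filter p).card = 11 * 2 ^ (e + 4) + 32 := by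
    intro e
    induction e with
    | zero => rw [Nat.zero_add, h4]; norm_num
    | succ e ih =>
      have hs := step (e + 4)
      have e1 : e + 1 + 4 = e + 4 + 1 := by ring
      rw [e1, hs]
      have e2 : 2 ^ (e + 4 + 1) = 32 * 2 ^ e := by ring
      have e3 : 2 ^ (e + 4) = 16 * 2 ^ e := by ring
      rw [e3] at ih ⊢
      rw [e2]
      omega
  match d with
  | 0 => rw [h0]; norm_num
  | 1 => rw [h1]; norm_num
  | 2 => rw [h2]; norm_num
  | 3 => rw [h3]; norm_num
  | e + 4 =>
    have := h5 e
    omega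

/-- The positive constant 5 at powers of two makes the lower bound strict, the worst case being `N`
at the threshold. The constant 47 is 32 plus at most 15 from the floor. -/
lemma card_filter_Icc_one_bounds (hp1 : p 1)
    (hp : ∀ d n, 2 ^ d < n → n ≤ 2 ^ (d + 1) → (p n ↔ 21 * 2 ^ d / 16 < n)) {N : ℕ}
    (hN : 1 ≤ N) : 11 * N < 21 * ((Finset.Icc 1 N).filter p).card ∧
      16 * ((Finset.Icc 1 N).filter p).card ≤ 11 * N + 47 := by
  have hlog1 := Nat.pow_log_le_self 2 (Nat.one_le_iff_ne_zero.1 hN)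
  have hlog2 := (Nat.lt_pow_succ_log_self one_lt_two N).le
  have hd := card_filter_Icc_one_two_pow hp1 hp (Nat.log 2 N)
  rw [card_filter_Icc_one_of_dyadic hp hlog1 hlog2]
  rw [Nat.succ_eq_add_one, pow_succ] at hlog2
  omega

lemma liminf_limsup_card_filter_Icc_one_div (hp1 : p 1)
    (hp : ∀ d n, 2 ^ d < n → n ≤ 2 ^ (d + 1) → (p n ↔ 21 * 2 ^ d / 16 < n)) :
    Filter.liminf (fun N : ℕ => (((Finset.Icc 1 N).filter p).card : ℝ) / N) Filter.atTop =
        11 / 21 ∧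
      Filter.limsup (fun N : ℕ => (((Finset.Icc 1 N).filter p).card : ℝ) / N) Filter.atTop =
        11 / 16 := by
  set f : ℕ → ℝ := fun N => (((Finset.Icc 1 N).filter p).card : ℝ) / N with hf
  have lower : ∀ᶠ N in Filter.atTop, 11 / 21 ≤ f N := by
    filter_upwards [Filter.eventually_ge_atTop 1] with N hN
    have h := (card_filter_Icc_one_bounds hp1 hp hN).1
    have hN' : (0 : ℝ) < N := by exact_mod_cast hN
    rw [hf, le_div_iff₀ hN']
    have h' : (11 * N : ℝ) < 21 * ((Finset.Icc 1 N).filter p).card := by exact_mod_cast h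
    linarith
  have upper : ∀ ε : ℝ, 0 < ε → ∀ᶠ N in Filter.atTop, f N ≤ 11 / 16 + ε := by
    intro ε hε
    obtain ⟨K, hK⟩ := exists_nat_gt (47 / ε)
    filter_upwards [Filter.eventually_ge_atTop (max 1 K)] with N hN
    have h := (card_filter_Icc_one_bounds hp1 hp (le_of_max_le_left hN)).2
    have hN' : (0 : ℝ) < N := by exact_mod_cast le_of_max_le_left hN
    have hKN : (K : ℝ) ≤ N := by exact_mod_cast le_of_max_le_right hN
    rw [hf, div_le_iff₀ hN']
    have h' : (16 * ((Finset.Icc 1 N).filter p).card : ℝ) ≤ 11 * N + 47 := by exact_mod_cast h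
    have h2 : 47 < N * ε := (div_lt_iff₀ hε).1 (hK.trans_le hKN)
    linarith
  have frequently_lower : ∀ ε : ℝ, 0 < ε → ∃ᶠ N in Filter.atTop, f N ≤ 11 / 21 + ε := by
    intro ε hε
    rw [Filter.frequently_atTop]
    intro a
    obtain ⟨K, hK⟩ := exists_nat_gt (2 / ε)
    set e := max a K with he
    have hlt : e < 2 ^ e := Nat.lt_two_pow_self
    -- For `d = e + 4` this is exactly the threshold, so the count is still that at `2 ^ d`, namely
    -- at most `11 * 2 ^ e + 2`.
    refine ⟨21 * 2 ^ e, by omega, ?_⟩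
    have h1 := (card_filter_Icc_one_two_pow hp1 hp (e + 4)).2
    have e3 : 2 ^ (e + 4) = 16 * 2 ^ e := by ring
    have e2 : 2 ^ (e + 4 + 1) = 32 * 2 ^ e := by ring
    have h2 := card_filter_Icc_one_of_dyadic hp (d := e + 4) (N := 21 * 2 ^ e) (by omega)
      (by omega)
    have h3 : ((Finset.Icc 1 (21 * 2 ^ e)).filter p).card ≤ 11 * 2 ^ e + 2 := by omega
    have h3' : (((Finset.Icc 1 (21 * 2 ^ e)).filter p).card : ℝ) ≤ 11 * 2 ^ e + 2 := by
      exact_mod_cast h3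
    have hKe : (K : ℝ) ≤ 2 ^ e := by
      exact_mod_cast (le_max_right a K).trans hlt.le
    have h4 : 2 < 2 ^ e * ε := (div_lt_iff₀ hε).1 (hK.trans_le hKe)
    rw [hf]
    dsimp only
    push_cast
    rw [div_le_iff₀ (by positivity)]
    nlinarith
  have frequently_upper : ∃ᶠ N in Filter.atTop, 11 / 16 ≤ f N := by
    rw [Filter.frequently_atTop]
    intro a
    refine ⟨2 ^ a, Nat.lt_two_pow_self.le, ?_⟩
    have h1 := (card_filter_Icc_one_two_pow hp1 hp a).1
    have h1' : (11 * 2 ^ a + 5 : ℝ) ≤ 16 * ((Finset.Icc 1 (2 ^ a)).filter p).card := by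
      exact_mod_cast h1
    rw [hf]
    dsimp only
    push_cast
    rw [le_div_iff₀ (by positivity)]
    linarith
  have bdd_le : Filter.IsBoundedUnder (· ≤ ·) Filter.atTop f :=
    Filter.isBoundedUnder_of_eventually_le (upper 1 one_pos)
  have bdd_ge : Filter.IsBoundedUnder (· ≥ ·) Filter.atTop f :=
    Filter.isBoundedUnder_of_eventually_ge lower
  refine ⟨le_antisymm (le_of_forall_pos_le_add fun ε hε => ?_) ?_,
    le_antisymm (le_of_forall_pos_le_add fun ε hε => ?_) ?_⟩
  · exact Filter.liminf_le_of_frequently_le (frequently_lower ε hε) bdd_ge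
  · exact Filter.le_liminf_of_le bdd_le.isCoboundedUnder_ge lower
  · exact Filter.limsup_le_of_le bdd_ge.isCoboundedUnder_le (upper ε hε)
  · exact Filter.le_limsup_of_frequently_le frequently_upper bdd_le

end Density

theorem mainTheorem3 (F : Type*) [Field F] :
    (∀ N : ℕ, 1 ≤ N → 11 / 21 < twoGenProportion F N ∧ twoGenProportion F N ≤ 1) ∧
      Filter.liminf (fun N : ℕ => twoGenProportion F N) Filter.atTop = 11 / 21 ∧
      Filter.limsup (fun N : ℕ => twoGenProportion F N) Filter.atTop = 11 / 16 := by
  classical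
  let p : ℕ → Prop := fun n => HasTwoGenSubgroupOfMaxDerivedLength (unitriangular n F)
  have hp1 : p 1 := hasTwoGenSubgroupOfMaxDerivedLength_unitriangular_one
  have hp : ∀ d n, 2 ^ d < n → n ≤ 2 ^ (d + 1) → (p n ↔ 21 * 2 ^ d / 16 < n) := fun d n h1 h2 =>
    hasTwoGenSubgroupOfMaxDerivedLength_unitriangular_iff h1 h2
  have hG : ∀ N, twoGenProportion F N = (((Finset.Icc 1 N).filter p).card : ℝ) / N := fun N => by
    rw [twoGenProportion]
  refine ⟨fun N hN => ?_, ?_⟩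
  · have hN' : (0 : ℝ) < N := by exact_mod_cast hN
    rw [hG, lt_div_iff₀ hN', div_le_one hN']
    have h := (card_filter_Icc_one_bounds hp1 hp hN).1
    have h' : (11 * N : ℝ) < 21 * ((Finset.Icc 1 N).filter p).card := by exact_mod_cast h
    have h2 : ((Finset.Icc 1 N).filter p).card ≤ N := by
      simpa using Finset.card_filter_le (Finset.Icc 1 N) p
    exact ⟨by linarith, by exact_mod_cast h2⟩
  · simp_rw [hG]
    exact liminf_limsup_card_filter_Icc_one_div hp1 hp
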